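/- Let $(\Omega,\mathcal F,\mu)$ be a finite measure space and let $E$ be a separable real Banach space with dual $E^*$ and Borel $\sigma$-algebra $\mathcal B(E)$. Let $(f_k)$ be a sequence of Bochner $\mu$-integrable functions $\Omega\to E$ and let $f_0:\Omega\to E$ be Bochner $\mu$-integrable. Then $(f_k)$ converges strongly to $f_0$, that is, $\int_\Omega\|f_k-f_0\|\,d\mu\to 0$, if and only if the following three conditions hold. (1) $(f_k)$ converges weakly to $f_0$: $\int_\Omega\langle f_k,g\rangle\,d\mu\to\int_\Omega\langle f_0,g\rangle\,d\mu$ for every norm-bounded function $g:\Omega\to E^*$ that is scalarly measurable, i.e. such that $\omega\mapsto\langle x,g(\omega)\rangle$ is measurable for each $x\in E$. (2) $(f_k)$ satisfies the sequential Bocce criterion: for each subsequence $(f_{k_j})$, each $\epsilon>0$ and each $B\in\mathcal F$ with $\mu(B)>0$ there is a set $A\in\mathcal F$ with $A\subseteq B$ and $\mu(A)>0$ such that $$\liminf_{j}\ \frac1{\mu(A)}\int_A\|f_{k_j}-m_A(f_{k_j})\|\,d\mu<\epsilon,\qquad\text{where } m_A(f)=\frac1{\mu(A)}\int_A f\,d\mu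 .$$ (3) $(f_k)$ is tight: for each $\epsilon>0$ there is a map $F_\epsilon$ from $\Omega$ to the compact subsets of $E$, whose graph $\{(\omega,x)\in\Omega\times E: x\in F_\epsilon(\omega)\}$ belongs to $\mathcal F\otimes\mathcal B(E)$, such that $\mu(\{\omega\in\Omega: f_k(\omega)\notin F_\epsilon(\omega)\})\le\epsilon$ for every $k$. -/

import Mathlib

open MeasureTheory Filter Topology
open scoped ENNReal

/-- Convergence in the seminorm `‖f‖₁ = ∫ ‖f‖ dμ` of the space of Bochner integrable functions. -/
def StronglyConverges {Ω E : Type*} [MeasurableSpace Ω] [NormedAddCommGroup E]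
    (μ : Measure Ω) (f : ℕ → Ω → E) (f₀ : Ω → E) : Prop :=
  Tendsto (fun k => ∫ ω, ‖f k ω - f₀ ω‖ ∂μ) atTop (𝓝 0)

/-- The bounded scalarly measurable functions `g : Ω → E*`: the norm of `g` is bounded and
`ω ↦ g ω x` is measurable for each `x` in `E`. They represent the dual of `L¹(μ; E)`. -/
structure IsBoundedScalarlyMeasurable {Ω E : Type*} [MeasurableSpace Ω] [NormedAddCommGroup E]
    [NormedSpace ℝ E] (g : Ω → StrongDual ℝ E) : Prop where
  measurable_apply : ∀ x : E, Measurable fun ω => g ω x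
  bounded : ∃ C : ℝ, ∀ ω, ‖g ω‖ ≤ C

/-- Weak convergence in the space of Bochner integrable functions: convergence of
`∫ ⟨f k, g⟩ dμ` for every bounded scalarly measurable `g : Ω → E*`. -/
def WeaklyConverges {Ω E : Type*} [MeasurableSpace Ω] [NormedAddCommGroup E] [NormedSpace ℝ E]
    (μ : Measure Ω) (f : ℕ → Ω → E) (f₀ : Ω → E) : Prop :=
  ∀ g : Ω → StrongDual ℝ E, IsBoundedScalarlyMeasurable g →
    Tendsto (fun k => ∫ ω, g ω (f k ω) ∂μ) atTop (𝓝 (∫ ω, g ω (f₀ ω) ∂μ))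

/-- The Bocce oscillation of `f` over `A`: the mean over `A` of `‖f - m_A(f)‖`, where `m_A(f)` is
the average `⨍ ω in A, f ω ∂μ`. It is valued in `[0, ∞]`, so that the limit inferior of a sequence
of oscillations is the genuine one even if the sequence is unbounded. -/
noncomputable def bocceOsc {Ω E : Type*} [MeasurableSpace Ω] [NormedAddCommGroup E]
    [NormedSpace ℝ E] (μ : Measure Ω) (f : Ω → E) (A : Set Ω) : ℝ≥0∞ :=
  (∫⁻ ω in A, ‖f ω - ⨍ ω' in A, f ω' ∂μ‖ₑ ∂μ) / μ A

/-- The sequential Bocce criterion: for every subsequence, every `ε > 0` and every measurable `B`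
of positive measure there is a measurable `A ⊆ B` of positive measure on which the limit inferior
of the Bocce oscillations of the subsequence is less than `ε`. -/
def SequentialBocceCriterion {Ω E : Type*} [MeasurableSpace Ω] [NormedAddCommGroup E]
    [NormedSpace ℝ E] (μ : Measure Ω) (f : ℕ → Ω → E) : Prop :=
  ∀ φ : ℕ → ℕ, StrictMono φ → ∀ ε : ℝ, 0 < ε → ∀ B : Set Ω, MeasurableSet B → 0 < μ B →
    ∃ A : Set Ω, MeasurableSet A ∧ A ⊆ B ∧ 0 < μ A ∧
      liminf (fun j => bocceOsc μ (f (φ j)) A) atTop < ENNReal.ofReal ε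

/-- Tightness of a set `L` of functions `Ω → E`: for each `ε > 0` there is a multifunction `F`
from `Ω` to the compact subsets of `E`, with graph measurable for the product of the σ-algebra of
`Ω` and the Borel σ-algebra of `E`, such that `μ {ω | f ω ∉ F ω} ≤ ε` for each `f` in `L`. -/
def IsTightFunctionSet {Ω E : Type*} [MeasurableSpace Ω] [NormedAddCommGroup E]
    [MeasurableSpace E] [BorelSpace E] (μ : Measure Ω) (L : Set (Ω → E)) : Prop :=
  ∀ ε : ℝ, 0 < ε → ∃ F : Ω → Set E, (∀ ω, IsCompact (F ω)) ∧
    MeasurableSet {p : Ω × E | p.2 ∈ F p.1} ∧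
    ∀ f ∈ L, μ {ω | f ω ∉ F ω} ≤ ENNReal.ofReal ε

/-! Strong convergence gives the three conditions by direct estimates. The converse rests on four
facts.

Weak convergence alone makes `f k - f₀` uniformly integrable: otherwise a gliding hump produces one
bounded `g` whose pairings with infinitely many terms stay away from zero
(`unifIntegrable_of_weaklyConverges_zero`).

Tightness and uniform integrability make the averages of `f k` over a fixed set relatively compact,
and weak convergence identifies their only cluster point. Hence these averages converge in norm to
that of `f₀` (`WeaklyConverges.tendsto_setAverage`).

Inside a set where `f₀` is nearly constant, the Bocce criterion provides a set `A` on which `f k` is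
infinitely often close in mean to its average, hence to the average of `f₀`, hence to `f₀` itself
(`SequentialBocceCriterion.exists_frequently_setLIntegral_le`).

These local estimates hold along subsequences that depend on `A`. An exhaustion patches them along a
common infinite index set, up to a remainder of small measure (`exists_infinite_setLIntegral_le`),
and uniform integrability controls the remainder. If strong convergence failed, this would apply to
indices whose distance to `f₀` stays above a fixed `η`. -/

/-! ### Pairing with scalarly measurable functionals -/

section Pairing

variable {Ω E : Type*} [MeasurableSpace Ω] [NormedAddCommGroup E] [NormedSpace ℝ E]
  {μ : Measure Ω}

/-- The pairing `(x, ω) ↦ g ω x` is a Carathéodory function, continuous in `x` and measurable in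
`ω`, hence jointly measurable as `E` is separable. No strong measurability of `g` is needed. -/
theorem IsBoundedScalarlyMeasurable.aestronglyMeasurable_apply
    [TopologicalSpace.SeparableSpace E]
    {g : Ω → StrongDual ℝ E} (hg : IsBoundedScalarlyMeasurable g) {f : Ω → E}
    (hf : AEStronglyMeasurable f μ) : AEStronglyMeasurable (fun ω => g ω (f ω)) μ := by
  borelize E
  have : SecondCountableTopology E := UniformSpace.secondCountable_of_separable E
  have h := measurable_uncurry_of_continuous_of_measurable (u := fun (x : E) (ω : Ω) => g ω x)
    (fun ω => (g ω).continuous) hg.measurable_apply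
  exact (h.comp_aemeasurable (hf.aemeasurable.prodMk aemeasurable_id)).aestronglyMeasurable

theorem IsBoundedScalarlyMeasurable.integrable_apply [TopologicalSpace.SeparableSpace E]
    {g : Ω → StrongDual ℝ E} (hg : IsBoundedScalarlyMeasurable g) {f : Ω → E}
    (hf : Integrable f μ) : Integrable (fun ω => g ω (f ω)) μ := by
  obtain ⟨C, hC⟩ := hg.bounded
  refine (hf.norm.const_mul C).mono' (hg.aestronglyMeasurable_apply hf.1) (ae_of_all _ fun ω => ?_)
  exact (g ω).le_of_opNorm_le (hC ω) _

theorem isBoundedScalarlyMeasurable_const (x' : StrongDual ℝ E) :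
    IsBoundedScalarlyMeasurable fun _ : Ω => x' :=
  ⟨fun _ => measurable_const, ‖x'‖, fun _ => le_rfl⟩

theorem IsBoundedScalarlyMeasurable.piecewise {g g' : Ω → StrongDual ℝ E}
    (hg : IsBoundedScalarlyMeasurable g) (hg' : IsBoundedScalarlyMeasurable g')
    {A : Set Ω} (hA : MeasurableSet A) [DecidablePred (· ∈ A)] :
    IsBoundedScalarlyMeasurable (A.piecewise g g') := by
  obtain ⟨C, hC⟩ := hg.bounded
  obtain ⟨C', hC'⟩ := hg'.bounded
  refine ⟨fun x => ?_, max C C', fun ω => ?_⟩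
  · have h : (fun ω => A.piecewise g g' ω x) = A.piecewise (fun ω => g ω x) fun ω => g' ω x := by
      ext ω
      by_cases h : ω ∈ A <;> simp [h]
    rw [h]
    exact (hg.measurable_apply x).piecewise hA (hg'.measurable_apply x)
  · by_cases h : ω ∈ A
    · simpa [h] using Or.inl (hC ω)
    · simpa [h] using Or.inr (hC' ω)

theorem IsBoundedScalarlyMeasurable.neg {g : Ω → StrongDual ℝ E}
    (hg : IsBoundedScalarlyMeasurable g) : IsBoundedScalarlyMeasurable fun ω => -g ω :=
  ⟨fun x => (hg.measurable_apply x).neg, by simpa using hg.bounded⟩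

/-- A separable space has a sequence of functionals of norm at most one that norms each vector up
to the factor `1 / 2`. -/
theorem exists_seq_strongDual_half_norm_le (E : Type*) [NormedAddCommGroup E] [NormedSpace ℝ E]
    [TopologicalSpace.SeparableSpace E] :
    ∃ e : ℕ → StrongDual ℝ E, (∀ i, ‖e i‖ ≤ 1) ∧ ∀ x, ∃ i, ‖x‖ / 2 ≤ e i x := by
  choose e he hex using fun i => exists_dual_vector'' ℝ (TopologicalSpace.denseSeq E i)
  refine ⟨e, he, fun x => ?_⟩
  rcases eq_or_ne x 0 with rfl | hx
  · exact ⟨0, by simp⟩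
  -- With `y` within `‖x‖ / 4` of `x`, both `‖y‖` and `e i (x - y)` lose at most `‖x‖ / 4`, which
  -- leaves `‖x‖ / 2`.
  obtain ⟨i, hi⟩ := (TopologicalSpace.denseRange_denseSeq E).exists_dist_lt x
    (show 0 < ‖x‖ / 4 by positivity)
  refine ⟨i, ?_⟩
  set y := TopologicalSpace.denseSeq E i
  rw [dist_eq_norm] at hi
  have h1 : e i (x - y) ≥ -(‖x‖ / 4) := by
    have := (e i).le_of_opNorm_le (he i) (x - y)
    rw [Real.norm_eq_abs] at this
    linarith [neg_abs_le (e i (x - y))]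
  have h2 : e i y = ‖y‖ := hex i
  have h3 : ‖x‖ ≤ ‖x - y‖ + ‖y‖ := by simpa using norm_add_le (x - y) y
  rw [map_sub, h2] at h1
  linarith

/-- Taking the first index that works in a countable norming family is a measurable selection; the
factor `1 / 2` is the price of countability. -/
theorem exists_isBoundedScalarlyMeasurable_half_norm_le [TopologicalSpace.SeparableSpace E]
    {f : Ω → E} (hf : AEStronglyMeasurable f μ) :
    ∃ g : Ω → StrongDual ℝ E, IsBoundedScalarlyMeasurable g ∧ (∀ ω, ‖g ω‖ ≤ 1) ∧
      ∀ᵐ ω ∂μ, ‖f ω‖ / 2 ≤ g ω (f ω) := by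
  classical
  obtain ⟨e, he, hex⟩ := exists_seq_strongDual_half_norm_le E
  borelize E
  have hm : Measurable hf.mk := hf.stronglyMeasurable_mk.measurable
  have hP : ∀ ω, ∃ i, ‖hf.mk f ω‖ / 2 ≤ e i (hf.mk f ω) := fun ω => hex _
  refine ⟨fun ω => e (Nat.find (hP ω)), ⟨fun x => ?_, 1, fun ω => he _⟩, fun ω => he _, ?_⟩
  · have hN : Measurable fun ω => Nat.find (hP ω) := measurable_find hP fun i =>
      measurableSet_le (hm.norm.div_const 2) ((e i).continuous.measurable.comp hm)
    exact (measurable_from_nat (f := fun i => e i x)).comp hN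
  · filter_upwards [hf.ae_eq_mk] with ω hω
    rw [hω]
    exact Nat.find_spec (hP ω)

end Pairing

/-! ### Uniform integrability in terms of integrals of norms -/

section UnifIntegrable

variable {Ω E ι : Type*} [MeasurableSpace Ω] [NormedAddCommGroup E] {μ : Measure Ω}

theorem eLpNorm_one_indicator_eq_ofReal {f : Ω → E} (hf : Integrable f μ) {A : Set Ω}
    (hA : MeasurableSet A) :
    eLpNorm (A.indicator f) 1 μ = ENNReal.ofReal (∫ ω in A, ‖f ω‖ ∂μ) := by
  rw [eLpNorm_indicator_eq_eLpNorm_restrict hA, eLpNorm_one_eq_lintegral_enorm,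
    ofReal_integral_norm_eq_lintegral_enorm hf.integrableOn]

theorem unifIntegrable_one_iff {f : ι → Ω → E} (hf : ∀ i, Integrable (f i) μ) :
    UnifIntegrable f 1 μ ↔ ∀ ε : ℝ, 0 < ε → ∃ δ : ℝ, 0 < δ ∧ ∀ i A, MeasurableSet A →
      μ A ≤ ENNReal.ofReal δ → ∫ ω in A, ‖f i ω‖ ∂μ ≤ ε := by
  constructor
  · intro h ε hε
    obtain ⟨δ, hδ, H⟩ := h hε
    refine ⟨δ, hδ, fun i A hA hμ => ?_⟩
    have := H i A hA hμ
    rwa [eLpNorm_one_indicator_eq_ofReal (hf i) hA, ENNReal.ofReal_le_ofReal_iff hε.le] at this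
  · intro h ε hε
    obtain ⟨δ, hδ, H⟩ := h ε hε
    refine ⟨δ, hδ, fun i A hA hμ => ?_⟩
    rw [eLpNorm_one_indicator_eq_ofReal (hf i) hA]
    exact ENNReal.ofReal_le_ofReal (H i A hA hμ)

theorem MeasureTheory.Integrable.exists_forall_setIntegral_norm_le {f : Ω → E} (hf : Integrable f μ) {ε : ℝ}
    (hε : 0 < ε) : ∃ δ : ℝ, 0 < δ ∧ ∀ A, MeasurableSet A → μ A ≤ ENNReal.ofReal δ →
      ∫ ω in A, ‖f ω‖ ∂μ ≤ ε := by
  have h := (unifIntegrable_one_iff (f := fun _ : Unit => f) fun _ => hf).1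
    (unifIntegrable_const le_rfl ENNReal.one_ne_top (memLp_one_iff_integrable.2 hf)) ε hε
  obtain ⟨δ, hδ, H⟩ := h
  exact ⟨δ, hδ, H ()⟩

end UnifIntegrable

theorem hasSum_half_mul_geometric_two (a : ℝ) :
    HasSum (fun j : ℕ => a / 2 * (1 / 2 : ℝ) ^ j) a := by
  have h := hasSum_geometric_two.mul_left (a / 2)
  rwa [div_mul_cancel₀ _ two_ne_zero] at h

/-! ### Gliding hump: weak convergence implies uniform integrability -/

section GlidingHump

variable {Ω E : Type*} [MeasurableSpace Ω] [NormedAddCommGroup E] [NormedSpace ℝ E]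
  {μ : Measure Ω}

/-- Overwriting a pairing on `A` by a norming functional or by its negative makes the integral
large. -/
theorem exists_piecewise_abs_integral_ge [TopologicalSpace.SeparableSpace E]
    {h : Ω → E} (hh : Integrable h μ) {A : Set Ω} (hA : MeasurableSet A) {ε : ℝ}
    (hε : ε < ∫ ω in A, ‖h ω‖ ∂μ) {g : Ω → StrongDual ℝ E} (hg : IsBoundedScalarlyMeasurable g)
    (hg1 : ∀ ω, ‖g ω‖ ≤ 1) :
    ∃ g' : Ω → StrongDual ℝ E, IsBoundedScalarlyMeasurable g' ∧ (∀ ω, ‖g' ω‖ ≤ 1) ∧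
      (∀ ω ∉ A, g' ω = g ω) ∧ ε / 2 ≤ |∫ ω, g' ω (h ω) ∂μ| := by
  classical
  obtain ⟨γ, hγ, hγ1, hγh⟩ := exists_isBoundedScalarlyMeasurable_half_norm_le hh.1
  have hp := hγ.piecewise hg hA
  have hm := hγ.neg.piecewise hg hA
  have hb : ∀ g₁ : Ω → StrongDual ℝ E, (∀ ω, ‖g₁ ω‖ ≤ 1) → ∀ ω, ‖A.piecewise g₁ g ω‖ ≤ 1 := by
    intro g₁ h₁ ω
    by_cases hω : ω ∈ A <;> simp [hω, h₁, hg1]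
  have hsplit : ∀ g₁ : Ω → StrongDual ℝ E, IsBoundedScalarlyMeasurable g₁ →
      ∫ ω, A.piecewise g₁ g ω (h ω) ∂μ
        = ∫ ω in A, g₁ ω (h ω) ∂μ + ∫ ω in Aᶜ, g ω (h ω) ∂μ := by
    intro g₁ h₁
    rw [← integral_add_compl hA ((h₁.piecewise hg hA).integrable_apply hh)]
    congr 1
    · exact setIntegral_congr_fun hA fun ω hω => by simp [hω]
    · exact setIntegral_congr_fun hA.compl fun ω hω => by
        simp [Set.piecewise_eq_of_notMem _ _ _ hω]
  have key : ε / 2 ≤ ∫ ω in A, γ ω (h ω) ∂μ := by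
    have : ∫ ω in A, ‖h ω‖ / 2 ∂μ ≤ ∫ ω in A, γ ω (h ω) ∂μ :=
      setIntegral_mono_ae (hh.norm.div_const 2).integrableOn (hγ.integrable_apply hh).integrableOn
        hγh
    rw [integral_div] at this
    linarith
  have e1 := hsplit γ hγ
  have e2 := hsplit _ hγ.neg
  simp only [neg_apply, integral_neg] at e2
  -- The integrals for the two signs differ by twice the integral of `γ ω (h ω)` over `A`, which is
  -- at least `ε`, so one of them has absolute value at least `ε / 2`.
  by_cases hcase : ε / 2 ≤ |∫ ω, A.piecewise γ g ω (h ω) ∂μ|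
  · exact ⟨_, hp, hb _ hγ1, fun ω hω => by simp [hω], hcase⟩
  · refine ⟨_, hm, hb _ (by simpa using hγ1), fun ω hω => by simp [hω], ?_⟩
    rw [not_le] at hcase
    have := abs_lt.1 hcase
    rw [le_abs]
    right
    linarith

/-- The eventual value of a sequence of scalarly measurable functions of norm at most one that are
changed on sets `A n` only. -/
theorem exists_eventual_value {A : ℕ → Set Ω} (hA : ∀ n, MeasurableSet (A n))
    {g : ℕ → Ω → StrongDual ℝ E} (hg : ∀ n, IsBoundedScalarlyMeasurable (g n))
    (hg1 : ∀ n ω, ‖g n ω‖ ≤ 1) (hstab : ∀ n, ∀ ω ∉ A n, g (n + 1) ω = g n ω) :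
    ∃ G : Ω → StrongDual ℝ E, IsBoundedScalarlyMeasurable G ∧ (∀ ω, ‖G ω‖ ≤ 1) ∧
      ∀ n, ∀ ω ∉ ⋃ j, A (n + j), G ω = g n ω := by
  classical
  have hstab' : ∀ n ω, ω ∉ ⋃ j, A (n + j) → ∀ j, g (n + j) ω = g n ω := by
    intro n ω hω j
    induction j with
    | zero => rfl
    | succ j ih =>
      rw [← ih]
      exact hstab (n + j) ω fun h => hω (Set.mem_iUnion.2 ⟨j, h⟩)
  have hanti : ∀ n m ω, n ≤ m → ω ∉ ⋃ j, A (n + j) → ω ∉ ⋃ j, A (m + j) := by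
    intro n m ω hnm hω h
    obtain ⟨j, hj⟩ := Set.mem_iUnion.1 h
    obtain ⟨i, rfl⟩ := Nat.exists_eq_add_of_le hnm
    exact hω (Set.mem_iUnion.2 ⟨i + j, by rwa [← add_assoc]⟩)
  -- Points lying in infinitely many `A n` have no eventual value; there `G` is zero, which is also
  -- the limit of the indicators used for measurability.
  let G : Ω → StrongDual ℝ E := fun ω =>
    if h : ∃ n, ω ∉ ⋃ j, A (n + j) then g (Nat.find h) ω else 0
  have hG : ∀ n, ∀ ω ∉ ⋃ j, A (n + j), G ω = g n ω := by
    intro n ω hω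
    have hex : ∃ n, ω ∉ ⋃ j, A (n + j) := ⟨n, hω⟩
    obtain ⟨i, hi⟩ := Nat.exists_eq_add_of_le (Nat.find_min' hex hω)
    simp only [G, dif_pos hex]
    rw [← hstab' _ ω (Nat.find_spec hex) i, ← hi]
  have hG1 : ∀ ω, ‖G ω‖ ≤ 1 := by
    intro ω
    by_cases h : ∃ n, ω ∉ ⋃ j, A (n + j)
    · simp only [G, dif_pos h, hg1]
    · simp only [G, dif_neg h, norm_zero, zero_le_one]
  refine ⟨G, ⟨fun x => ?_, 1, hG1⟩, hG1, hG⟩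
  refine measurable_of_tendsto_metrizable
    (f := fun n => (⋃ j, A (n + j))ᶜ.indicator fun ω => g n ω x)
    (fun n => ((hg n).measurable_apply x).indicator (MeasurableSet.iUnion fun j => hA _).compl) ?_
  rw [tendsto_pi_nhds]
  intro ω
  by_cases h : ∃ n, ω ∉ ⋃ j, A (n + j)
  · obtain ⟨n, hn⟩ := h
    refine tendsto_const_nhds.congr' ?_
    filter_upwards [eventually_ge_atTop n] with m hm
    have hm' := hanti n m ω hm hn
    rw [Set.indicator_of_mem (Set.mem_compl hm'), hG m ω hm']
  · have h0 : G ω x = 0 := by simp only [G, dif_neg h, zero_apply]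
    rw [h0]
    refine tendsto_const_nhds.congr fun n => ?_
    rw [Set.indicator_of_notMem]
    exact fun hn => h ⟨n, hn⟩

theorem abs_integral_sub_le_of_eq_off [TopologicalSpace.SeparableSpace E]
    {h : Ω → E} (hh : Integrable h μ) {T : Set Ω}
    {g g' : Ω → StrongDual ℝ E} (hg : IsBoundedScalarlyMeasurable g)
    (hg' : IsBoundedScalarlyMeasurable g') (hg1 : ∀ ω, ‖g ω‖ ≤ 1) (hg1' : ∀ ω, ‖g' ω‖ ≤ 1)
    (heq : ∀ ω ∉ T, g ω = g' ω) :
    |∫ ω, g ω (h ω) ∂μ - ∫ ω, g' ω (h ω) ∂μ| ≤ 2 * ∫ ω in T, ‖h ω‖ ∂μ := by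
  have i1 := hg.integrable_apply hh
  have i2 := hg'.integrable_apply hh
  rw [← integral_sub i1 i2, ← setIntegral_eq_integral_of_forall_compl_eq_zero (s := T)
    (fun ω hω => by rw [heq ω hω, sub_self]), ← integral_const_mul, ← Real.norm_eq_abs]
  refine norm_integral_le_of_norm_le (hh.norm.const_mul 2).integrableOn (ae_of_all _ fun ω => ?_)
  calc ‖g ω (h ω) - g' ω (h ω)‖ ≤ ‖g ω (h ω)‖ + ‖g' ω (h ω)‖ := norm_sub_le _ _
    _ ≤ 1 * ‖h ω‖ + 1 * ‖h ω‖ :=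
      add_le_add ((g ω).le_of_opNorm_le (hg1 ω) _) ((g' ω).le_of_opNorm_le (hg1' ω) _)
    _ = 2 * ‖h ω‖ := by ring

/-- A sequence of Bochner integrable functions that converges weakly to zero is uniformly
integrable. -/
theorem unifIntegrable_of_weaklyConverges_zero [TopologicalSpace.SeparableSpace E]
    {h : ℕ → Ω → E} (hh : ∀ k, Integrable (h k) μ)
    (hw : ∀ g : Ω → StrongDual ℝ E, IsBoundedScalarlyMeasurable g →
      Tendsto (fun k => ∫ ω, g ω (h k ω) ∂μ) atTop (𝓝 0)) :
    UnifIntegrable h 1 μ := by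
  rw [unifIntegrable_one_iff hh]
  by_contra! hcon
  obtain ⟨ε, hε, hbad⟩ := hcon
  choose! κ S hSm hSμ hSε using hbad
  choose d hd0 hd using fun k =>
    (hh k).exists_forall_setIntegral_norm_le (show 0 < ε / 8 by positivity)
  -- `D n` bounds the measure of the tail union of the `A m` with `m ≥ n`. Halving makes the
  -- measures summable; the second term makes `h (k n)` have integral at most `ε / 8` over the next
  -- tail.
  let D : ℕ → ℝ := fun n => Nat.rec 1 (fun _ r => min (r / 2) (d (κ (r / 2)))) n
  have hDs : ∀ n, D (n + 1) = min (D n / 2) (d (κ (D n / 2))) := fun n => rfl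
  have hD0 : ∀ n, 0 < D n := by
    intro n
    induction n with
    | zero => exact one_pos
    | succ n ih => rw [hDs]; exact lt_min (half_pos ih) (hd0 _)
  set A : ℕ → Set Ω := fun n => S (D n / 2) with hAdef
  set k : ℕ → ℕ := fun n => κ (D n / 2) with hkdef
  have hA : ∀ n, MeasurableSet (A n) := fun n => hSm _ (half_pos (hD0 n))
  have hAμ : ∀ n, μ (A n) ≤ ENNReal.ofReal (D n / 2) := fun n => hSμ _ (half_pos (hD0 n))
  have hAε : ∀ n, ε < ∫ ω in A n, ‖h (k n) ω‖ ∂μ := fun n => hSε _ (half_pos (hD0 n))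
  have hDgeom : ∀ n j, D (n + j) ≤ D n * (1 / 2) ^ j := by
    intro n j
    induction j with
    | zero => simp
    | succ j ih =>
      calc D (n + (j + 1)) ≤ D (n + j) / 2 := by
            rw [← add_assoc, hDs]; exact min_le_left _ _
        _ ≤ D n * (1 / 2) ^ j / 2 := by linarith
        _ = _ := by rw [pow_succ]; ring
  have hTm : ∀ n, MeasurableSet (⋃ j, A (n + j)) := fun n => MeasurableSet.iUnion fun j => hA _
  have hTμ : ∀ n, μ (⋃ j, A (n + j)) ≤ ENNReal.ofReal (D n) := by
    intro n
    have hs : HasSum (fun j : ℕ => D n / 2 * (1 / 2 : ℝ) ^ j) (D n) :=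
      hasSum_half_mul_geometric_two _
    calc μ (⋃ j, A (n + j)) ≤ ∑' j, μ (A (n + j)) := measure_iUnion_le _
      _ ≤ ∑' j : ℕ, ENNReal.ofReal (D n / 2 * (1 / 2 : ℝ) ^ j) := by
        refine ENNReal.tsum_le_tsum fun j => (hAμ _).trans (ENNReal.ofReal_le_ofReal ?_)
        linarith [hDgeom n j]
      _ = ENNReal.ofReal (D n) := by
        rw [← ENNReal.ofReal_tsum_of_nonneg _ hs.summable, hs.tsum_eq]
        intro j
        have := hD0 n
        positivity
  have hTε : ∀ n, ∫ ω in ⋃ j, A (n + 1 + j), ‖h (k n) ω‖ ∂μ ≤ ε / 8 := fun n =>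
    hd _ _ (hTm _) ((hTμ _).trans (ENNReal.ofReal_le_ofReal (min_le_right _ _)))
  -- On a later set `A m`, the function `h (k n)` has small integral while `h (k m)` has integral
  -- above `ε`, so no index recurs.
  have hk : ∀ n m, n < m → k n ≠ k m := by
    intro n m hnm he
    obtain ⟨i, rfl⟩ := Nat.exists_eq_add_of_le (Nat.succ_le_of_lt hnm)
    have h1 : ∫ ω in A (n.succ + i), ‖h (k n) ω‖ ∂μ ≤ ε / 8 :=
      (setIntegral_mono_set (hh _).norm.integrableOn (ae_of_all _ fun _ => norm_nonneg _)
        (Set.subset_iUnion (fun j => A (n + 1 + j)) i).eventuallyLE).trans (hTε n)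
    have h2 := hAε (n.succ + i)
    rw [← he] at h2
    linarith
  have hkinj : Function.Injective k := by
    intro n m he
    by_contra hne
    rcases lt_or_gt_of_ne hne with hlt | hlt
    · exact hk _ _ hlt he
    · exact hk _ _ hlt he.symm
  choose! N hN hN1 hNoff hNbig using fun n (g : Ω → StrongDual ℝ E)
    (hg : IsBoundedScalarlyMeasurable g ∧ ∀ ω, ‖g ω‖ ≤ 1) =>
      exists_piecewise_abs_integral_ge (hh (k n)) (hA n) (hAε n) hg.1 hg.2
  let g : ℕ → Ω → StrongDual ℝ E := fun n => Nat.rec (fun _ => 0) (fun n r => N n r) n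
  have hg : ∀ n, IsBoundedScalarlyMeasurable (g n) ∧ ∀ ω, ‖g n ω‖ ≤ 1 := by
    intro n
    induction n with
    | zero => exact ⟨isBoundedScalarlyMeasurable_const 0, fun ω => by simp [g]⟩
    | succ n ih => exact ⟨hN n _ ih, hN1 n _ ih⟩
  obtain ⟨G, hG, hG1, hGoff⟩ := exists_eventual_value hA (fun n => (hg n).1) (fun n => (hg n).2)
    fun n => hNoff n _ (hg n)
  -- Stage `n + 1` gives `ε / 2`, and later changes, confined to the next tail, cost at most `2 * (ε
  -- / 8)`.
  have hbig : ∀ n, ε / 4 ≤ |∫ ω, G ω (h (k n) ω) ∂μ| := by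
    intro n
    have h1 : ε / 2 ≤ |∫ ω, g (n + 1) ω (h (k n) ω) ∂μ| := hNbig n _ (hg n)
    have h2 := abs_integral_sub_le_of_eq_off (hh (k n)) hG (hg (n + 1)).1 hG1
      (hg (n + 1)).2 (hGoff (n + 1))
    have h3 := hTε n
    have h4 := abs_sub_abs_le_abs_sub (∫ ω, g (n + 1) ω (h (k n) ω) ∂μ) (∫ ω, G ω (h (k n) ω) ∂μ)
    rw [abs_sub_comm] at h4
    linarith
  have hlim := ((hw G hG).comp hkinj.nat_tendsto_atTop).abs
  rw [abs_zero] at hlim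
  have := ge_of_tendsto' hlim hbig
  linarith

end GlidingHump

/-! ### Tightness and finite unions of small balls -/

section Tightness

variable {Ω E : Type*} [MeasurableSpace Ω] [NormedAddCommGroup E] {μ : Measure Ω}

theorem iUnion_ball_denseSeq (E : Type*) [NormedAddCommGroup E]
    [TopologicalSpace.SeparableSpace E] {r : ℝ} (hr : 0 < r) :
    ⋃ i, Metric.ball (TopologicalSpace.denseSeq E i) r = Set.univ := by
  refine Set.eq_univ_of_forall fun x => ?_
  obtain ⟨i, hi⟩ := (TopologicalSpace.denseRange_denseSeq E).exists_dist_lt x hr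
  exact Set.mem_iUnion.2 ⟨i, hi⟩

/-- A tight set of functions is uniformly concentrated on finite unions of small balls. The outer
measures of the increasing sets `{ω | F ω ⊆ U n}` converge to that of the whole space, so no
measurability of these sets is required. -/
theorem IsTightFunctionSet.exists_finite_balls [IsFiniteMeasure μ] [MeasurableSpace E]
    [BorelSpace E] [TopologicalSpace.SeparableSpace E] {L : Set (Ω → E)}
    (hL : IsTightFunctionSet μ L) (hm : ∀ f ∈ L, AEMeasurable f μ) {r : ℝ} (hr : 0 < r)
    {δ : ℝ} (hδ : 0 < δ) :
    ∃ n : ℕ, ∀ f ∈ L, μ {ω | f ω ∉ ⋃ i ∈ Set.Iio n, Metric.ball (TopologicalSpace.denseSeq E i) r}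
      ≤ ENNReal.ofReal δ := by
  obtain ⟨F, hFc, -, hF⟩ := hL (δ / 2) (half_pos hδ)
  set U : ℕ → Set E := fun n => ⋃ i ∈ Set.Iio n, Metric.ball (TopologicalSpace.denseSeq E i) r
    with hU
  have hUo : ∀ n, IsOpen (U n) := fun n => isOpen_biUnion fun _ _ => Metric.isOpen_ball
  have hUmono : Monotone U := fun n m hnm =>
    Set.biUnion_subset_biUnion_left (Set.Iio_subset_Iio hnm)
  have hUuniv : ⋃ n, U n = Set.univ := by
    refine Set.eq_univ_of_forall fun x => ?_
    have hx : x ∈ ⋃ i, Metric.ball (TopologicalSpace.denseSeq E i) r := by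
      rw [iUnion_ball_denseSeq E hr]; trivial
    obtain ⟨i, hi⟩ := Set.mem_iUnion.1 hx
    exact Set.mem_iUnion.2 ⟨i + 1, Set.mem_biUnion (Set.mem_Iio.2 i.lt_succ_self) hi⟩
  have hW : Monotone fun n => {ω | F ω ⊆ U n} := fun n m hnm ω h => h.trans (hUmono hnm)
  have hWuniv : ⋃ n, {ω | F ω ⊆ U n} = Set.univ := by
    refine Set.eq_univ_of_forall fun ω => Set.mem_iUnion.2 ?_
    exact (hFc ω).elim_directed_cover U hUo (by rw [hUuniv]; exact Set.subset_univ _)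
      hUmono.directed_le
  have hlim := tendsto_measure_iUnion_atTop (μ := μ) hW
  rw [hWuniv] at hlim
  have hpos : 0 < ENNReal.ofReal (δ / 2) := ENNReal.ofReal_pos.2 (half_pos hδ)
  have hev : ∀ᶠ n in atTop, μ Set.univ ≤ μ {ω | F ω ⊆ U n} + ENNReal.ofReal (δ / 2) := by
    have h2 := hlim.add_const (ENNReal.ofReal (δ / 2))
    exact (h2.eventually (lt_mem_nhds
      (ENNReal.lt_add_right (measure_ne_top μ _) hpos.ne'))).mono fun n hn => hn.le
  obtain ⟨n, hn⟩ := hev.exists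
  refine ⟨n, fun f hf => ?_⟩
  change μ {ω | f ω ∉ U n} ≤ _
  have hnull : NullMeasurableSet {ω | f ω ∈ U n} μ :=
    (hm f hf).nullMeasurableSet_preimage (hUo n).measurableSet
  have hsub : {ω | F ω ⊆ U n} ⊆ {ω | f ω ∈ U n} ∪ {ω | f ω ∉ F ω} := by
    intro ω hω
    by_cases h : f ω ∈ F ω
    · exact Or.inl (hω h)
    -- The next bound compares total masses, so that the finite quantity `μ {ω | f ω ∈ U n}` can be
    -- cancelled.
    · exact Or.inr h
  have hadd : μ {ω | f ω ∈ U n} + μ {ω | f ω ∉ U n} = μ Set.univ := measure_add_measure_compl₀ hnull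
  have hle : μ {ω | f ω ∈ U n} + μ {ω | f ω ∉ U n} ≤ μ {ω | f ω ∈ U n} + ENNReal.ofReal δ := by
    rw [hadd]
    calc μ Set.univ ≤ μ {ω | F ω ⊆ U n} + ENNReal.ofReal (δ / 2) := hn
      _ ≤ μ {ω | f ω ∈ U n} + ENNReal.ofReal (δ / 2) + ENNReal.ofReal (δ / 2) := by
        gcongr
        exact (measure_mono hsub).trans ((measure_union_le _ _).trans (by gcongr; exact hF f hf))
      _ = _ := by
        rw [add_assoc, ← ENNReal.ofReal_add (by positivity) (by positivity), add_halves]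
  exact (ENNReal.add_le_add_iff_left (measure_ne_top μ _)).1 hle

/-- A sequence uniformly concentrated on finite unions of small balls is tight. -/
theorem isTightFunctionSet_of_finite_balls [CompleteSpace E] [MeasurableSpace E]
    [BorelSpace E] {L : Set (Ω → E)}
    (h : ∀ r : ℝ, 0 < r → ∀ δ : ℝ, 0 < δ → ∃ t : Set E, t.Finite ∧
      ∀ f ∈ L, μ {ω | f ω ∉ ⋃ x ∈ t, Metric.closedBall x r} ≤ ENNReal.ofReal δ) :
    IsTightFunctionSet μ L := by
  intro ε hε
  choose t htf ht using fun m : ℕ => h (1 / (m + 1)) Nat.one_div_pos_of_nat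
    (ε / 2 * (1 / 2) ^ m) (by positivity)
  set K : Set E := ⋂ m : ℕ, ⋃ x ∈ t m, Metric.closedBall x (1 / (m + 1) : ℝ) with hK
  have hKc : IsClosed K := isClosed_iInter fun m =>
    (htf m).isClosed_biUnion fun _ _ => Metric.isClosed_closedBall
  have hKt : TotallyBounded K := by
    rw [Metric.totallyBounded_iff]
    intro η hη
    obtain ⟨m, hm⟩ := exists_nat_one_div_lt hη
    refine ⟨t m, htf m, (Set.iInter_subset _ m).trans ?_⟩
    exact Set.biUnion_mono subset_rfl fun x _ => Metric.closedBall_subset_ball hm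
  refine ⟨fun _ => K, fun _ => isCompact_iff_totallyBounded_isComplete.2 ⟨hKt, hKc.isComplete⟩,
    hKc.measurableSet.preimage measurable_snd, fun f hf => ?_⟩
  have hs : HasSum (fun m : ℕ => ε / 2 * (1 / 2 : ℝ) ^ m) ε :=
    hasSum_half_mul_geometric_two _
  calc μ {ω | f ω ∉ K}
      ≤ μ (⋃ m : ℕ, {ω | f ω ∉ ⋃ x ∈ t m, Metric.closedBall x (1 / (m + 1) : ℝ)}) := by
        refine measure_mono fun ω hω => ?_
        rw [Set.mem_ofPred_eq, hK, Set.mem_iInter, not_forall] at hω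
        exact Set.mem_iUnion.2 hω
    _ ≤ ∑' m : ℕ, ENNReal.ofReal (ε / 2 * (1 / 2 : ℝ) ^ m) :=
        (measure_iUnion_le _).trans (ENNReal.tsum_le_tsum fun m => ht m f hf)
    _ = ENNReal.ofReal ε := by
        rw [← ENNReal.ofReal_tsum_of_nonneg (fun _ => by positivity) hs.summable, hs.tsum_eq]

theorem tendsto_measure_notMem_closedBalls [IsFiniteMeasure μ] [TopologicalSpace.SeparableSpace E]
    {f : Ω → E} (hf : AEStronglyMeasurable f μ) {r : ℝ} (hr : 0 < r) :
    Tendsto (fun n : ℕ => μ {ω | f ω ∉ ⋃ i ∈ Set.Iio n,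
      Metric.closedBall (TopologicalSpace.denseSeq E i) r}) atTop (𝓝 0) := by
  borelize E
  set V : ℕ → Set E := fun n =>
    ⋃ i ∈ Set.Iio n, Metric.closedBall (TopologicalSpace.denseSeq E i) r
  have hV : ∀ n, MeasurableSet (V n) := fun n =>
    (((Set.finite_Iio n).isClosed_biUnion fun _ _ => Metric.isClosed_closedBall)).measurableSet
  have hnull : ∀ n, NullMeasurableSet {ω | f ω ∉ V n} μ := fun n =>
    hf.aemeasurable.nullMeasurableSet_preimage (hV n).compl
  have hanti : Antitone fun n => {ω | f ω ∉ V n} := fun n m hnm ω hω h =>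
    hω (Set.biUnion_subset_biUnion_left (Set.Iio_subset_Iio hnm) h)
  have hlim := tendsto_measure_iInter_atTop hnull hanti ⟨0, measure_ne_top μ _⟩
  have hempty : ⋂ n, {ω | f ω ∉ V n} = ∅ := by
    refine Set.eq_empty_of_forall_notMem fun ω hω => ?_
    have hx : f ω ∈ ⋃ i, Metric.ball (TopologicalSpace.denseSeq E i) r := by
      rw [iUnion_ball_denseSeq E hr]; trivial
    obtain ⟨i, hi⟩ := Set.mem_iUnion.1 hx
    exact Set.mem_iInter.1 hω (i + 1)
      (Set.mem_biUnion (Set.mem_Iio.2 i.lt_succ_self) (Metric.ball_subset_closedBall hi))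
  rwa [hempty, measure_empty] at hlim

/-- Each single function is concentrated on finitely many balls. The tail inherits this from `f₀` at
radius `r / 2`, and the finitely many remaining terms are handled one by one. -/
theorem isTightFunctionSet_range_of_tendstoInMeasure [IsFiniteMeasure μ] [CompleteSpace E]
    [TopologicalSpace.SeparableSpace E] [MeasurableSpace E] [BorelSpace E] {f : ℕ → Ω → E}
    {f₀ : Ω → E} (hf : ∀ k, AEStronglyMeasurable (f k) μ) (hf₀ : AEStronglyMeasurable f₀ μ)
    (h : TendstoInMeasure μ f atTop f₀) : IsTightFunctionSet μ (Set.range f) := by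
  refine isTightFunctionSet_of_finite_balls fun r hr δ hδ => ?_
  have hδ2 : 0 < ENNReal.ofReal (δ / 2) := ENNReal.ofReal_pos.2 (half_pos hδ)
  obtain ⟨N, hN⟩ := eventually_atTop.1
    ((h (ENNReal.ofReal (r / 2)) (ENNReal.ofReal_pos.2 (half_pos hr))).eventually_le_const hδ2)
  have h0 := (tendsto_measure_notMem_closedBalls hf₀ (half_pos hr)).eventually_le_const hδ2
  have hfin : ∀ᶠ n : ℕ in atTop, ∀ k ∈ Set.Iio N, μ {ω | f k ω ∉ ⋃ i ∈ Set.Iio n,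
      Metric.closedBall (TopologicalSpace.denseSeq E i) r} ≤ ENNReal.ofReal δ :=
    (Set.finite_Iio N).eventually_all.2 fun k _ =>
      (tendsto_measure_notMem_closedBalls (hf k) hr).eventually_le_const
        (ENNReal.ofReal_pos.2 hδ)
  obtain ⟨n, hn0, hn⟩ := (h0.and hfin).exists
  refine ⟨TopologicalSpace.denseSeq E '' Set.Iio n, (Set.finite_Iio n).image _, ?_⟩
  rintro _ ⟨k, rfl⟩
  rw [Set.biUnion_image]
  rcases lt_or_ge k N with hk | hk
  · exact hn k hk
  calc μ {ω | f k ω ∉ ⋃ i ∈ Set.Iio n, Metric.closedBall (TopologicalSpace.denseSeq E i) r}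
      ≤ μ ({ω | f₀ ω ∉ ⋃ i ∈ Set.Iio n, Metric.closedBall (TopologicalSpace.denseSeq E i) (r / 2)}
          ∪ {ω | ENNReal.ofReal (r / 2) ≤ edist (f k ω) (f₀ ω)}) := by
        refine measure_mono fun ω hω => ?_
        by_contra hcon
        rw [Set.mem_union, not_or, Set.mem_ofPred_eq, not_not, Set.mem_ofPred_eq, not_le] at hcon
        obtain ⟨h1, h2⟩ := hcon
        rw [edist_dist, ENNReal.ofReal_lt_ofReal_iff (half_pos hr)] at h2
        simp only [Set.mem_iUnion] at h1
        obtain ⟨i, hi, hi'⟩ := h1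
        refine hω (Set.mem_biUnion hi ?_)
        rw [Metric.mem_closedBall] at hi' ⊢
        linarith [dist_triangle (f k ω) (f₀ ω) (TopologicalSpace.denseSeq E i)]
    _ ≤ ENNReal.ofReal (δ / 2) + ENNReal.ofReal (δ / 2) :=
        (measure_union_le _ _).trans (add_le_add hn0 (hN k hk))
    _ = ENNReal.ofReal δ := by
        rw [← ENNReal.ofReal_add (by positivity) (by positivity), add_halves]

end Tightness

/-! ### Compactness and norm convergence of averages -/

section Averages

variable {Ω E : Type*} [MeasurableSpace Ω] [NormedAddCommGroup E] {μ : Measure Ω}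

theorem totallyBounded_of_forall_approx {X : Type*} [PseudoMetricSpace X] {s : Set X}
    (h : ∀ η : ℝ, 0 < η → ∃ C, TotallyBounded C ∧ ∀ y ∈ s, ∃ z ∈ C, dist y z ≤ η) :
    TotallyBounded s := by
  rw [Metric.totallyBounded_iff]
  intro η hη
  obtain ⟨C, hC, hs⟩ := h (η / 2) (half_pos hη)
  obtain ⟨t, ht, hCt⟩ := Metric.totallyBounded_iff.1 hC (η / 2) (half_pos hη)
  refine ⟨t, ht, fun y hy => ?_⟩
  obtain ⟨z, hz, hyz⟩ := hs y hy
  obtain ⟨x, hx, hzx⟩ := Set.mem_iUnion₂.1 (hCt hz)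
  refine Set.mem_biUnion hx ?_
  rw [Metric.mem_ball] at hzx ⊢
  linarith [dist_triangle y z x]

/-- A measurable map with values in a finite set that moves the points of finitely many balls of
radius `r` by at most `r`, and that vanishes off these balls. -/
theorem exists_measurable_finite_approx [MeasurableSpace E] [OpensMeasurableSpace E] (e : ℕ → E)
    (n : ℕ) (r : ℝ) :
    ∃ p : E → E, Measurable p ∧ (∀ x, p x ∈ insert 0 (e '' Set.Iic n)) ∧
      (∀ x ∈ ⋃ i ∈ Set.Iio n, Metric.ball (e i) r, dist x (p x) ≤ r) ∧
      ∀ x ∉ ⋃ i ∈ Set.Iio n, Metric.ball (e i) r, p x = 0 := by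
  classical
  have hU : MeasurableSet (⋃ i ∈ Set.Iio n, Metric.ball (e i) r) :=
    (isOpen_biUnion fun _ _ => Metric.isOpen_ball).measurableSet
  refine ⟨(⋃ i ∈ Set.Iio n, Metric.ball (e i) r).piecewise (SimpleFunc.nearestPt e n) 0,
    (SimpleFunc.measurable _).piecewise hU measurable_const, fun x => ?_, fun x hx => ?_,
    fun x hx => by rw [Set.piecewise_eq_of_notMem _ _ _ hx]; rfl⟩
  · by_cases hx : x ∈ ⋃ i ∈ Set.Iio n, Metric.ball (e i) r
    · rw [Set.piecewise_eq_of_mem _ _ _ hx]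
      exact Or.inr ⟨_, SimpleFunc.nearestPtInd_le e n x, rfl⟩
    · rw [Set.piecewise_eq_of_notMem _ _ _ hx]
      exact Or.inl rfl
  · rw [Set.piecewise_eq_of_mem _ _ _ hx]
    obtain ⟨i, hi, hxi⟩ := Set.mem_iUnion₂.1 hx
    have h := SimpleFunc.edist_nearestPt_le e x (le_of_lt hi)
    rw [edist_comm, edist_comm (e i)] at h
    rw [edist_dist, edist_dist, ENNReal.ofReal_le_ofReal_iff dist_nonneg] at h
    exact h.trans (Metric.mem_ball.1 hxi).le

variable [NormedSpace ℝ E]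

theorem norm_setAverage_le {f : Ω → E} {A : Set Ω} :
    ‖⨍ ω in A, f ω ∂μ‖ ≤ (μ.real A)⁻¹ * ∫ ω in A, ‖f ω‖ ∂μ := by
  rw [setAverage_eq, norm_smul, norm_inv, Real.norm_of_nonneg measureReal_nonneg]
  gcongr
  exact norm_integral_le_integral_norm _

theorem setAverage_sub {f g : Ω → E} {A : Set Ω} (hf : IntegrableOn f A μ)
    (hg : IntegrableOn g A μ) :
    ⨍ ω in A, (f ω - g ω) ∂μ = ⨍ ω in A, f ω ∂μ - ⨍ ω in A, g ω ∂μ := by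
  simp only [setAverage_eq]
  rw [integral_sub hf hg, smul_sub]

/-- The averages over a fixed set of a tight and uniformly integrable sequence form a totally
bounded set. -/
theorem totallyBounded_range_setAverage [IsFiniteMeasure μ] [CompleteSpace E]
    [TopologicalSpace.SeparableSpace E] [MeasurableSpace E] [BorelSpace E] {f : ℕ → Ω → E}
    (hf : ∀ k, Integrable (f k) μ) (hu : UnifIntegrable f 1 μ)
    (ht : IsTightFunctionSet μ (Set.range f)) {A : Set Ω} (hμA : 0 < μ A) :
    TotallyBounded (Set.range fun k => ⨍ ω in A, f k ω ∂μ) := by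
  refine totallyBounded_of_forall_approx fun η hη => ?_
  have ha : 0 < μ.real A := ENNReal.toReal_pos hμA.ne' (measure_ne_top μ A)
  obtain ⟨δ, hδ, hδf⟩ := (unifIntegrable_one_iff hf).1 hu (η / 2 * μ.real A) (by positivity)
  obtain ⟨n, hn⟩ := ht.exists_finite_balls (by rintro _ ⟨k, rfl⟩; exact (hf k).1.aemeasurable)
    (half_pos hη) hδ
  set e := TopologicalSpace.denseSeq E
  set U := ⋃ i ∈ Set.Iio n, Metric.ball (e i) (η / 2)
  obtain ⟨p, hpm, hpv, hpU, hpU'⟩ := exists_measurable_finite_approx e n (η / 2)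
  have hfin : (insert 0 (e '' Set.Iic n)).Finite := ((Set.finite_Iic n).image e).insert 0
  have hC : IsCompact (convexHull ℝ (insert 0 (e '' Set.Iic n))) := hfin.isCompact_convexHull ℝ
  refine ⟨_, hC.totallyBounded, ?_⟩
  rintro _ ⟨k, rfl⟩
  obtain ⟨R, hR⟩ := hfin.isBounded.exists_norm_le
  have hps : Integrable (fun ω => p (f k ω)) μ :=
    Integrable.of_bound (hpm.comp_aemeasurable (hf k).1.aemeasurable).aestronglyMeasurable R
      (ae_of_all _ fun ω => hR _ (hpv _))
  -- The average of the finitely valued approximation lies in the compact convex hull of its values,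
  -- which does not depend on `k`.
  refine ⟨⨍ ω in A, p (f k ω) ∂μ, (convex_convexHull ℝ _).set_average_mem hC.isClosed hμA.ne'
    (measure_ne_top μ A) (ae_of_all _ fun ω => subset_convexHull ℝ _ (hpv _)) hps.integrableOn, ?_⟩
  -- The exceptional set is only null measurable, hence the measurable hull.
  set B := toMeasurable μ {ω | f k ω ∉ U}
  have hB : MeasurableSet B := measurableSet_toMeasurable _ _
  have hBf : ∫ ω in B, ‖f k ω‖ ∂μ ≤ η / 2 * μ.real A :=
    hδf k B hB (by rw [measure_toMeasurable]; exact hn _ ⟨k, rfl⟩)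
  have hpt : ∀ ω, ‖f k ω - p (f k ω)‖ ≤ η / 2 + B.indicator (fun ω => ‖f k ω‖) ω := by
    intro ω
    by_cases hω : f k ω ∈ U
    · rw [← dist_eq_norm]
      exact (hpU _ hω).trans (le_add_of_nonneg_right
        (Set.indicator_nonneg (fun _ _ => norm_nonneg _) _))
    · rw [hpU' _ hω, sub_zero, Set.indicator_of_mem (subset_toMeasurable μ _ hω)]
      linarith
  have hint : ∫ ω in A, ‖f k ω - p (f k ω)‖ ∂μ ≤ η * μ.real A := by
    have hi : Integrable (B.indicator fun ω => ‖f k ω‖) μ := (hf k).norm.indicator hB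
    calc ∫ ω in A, ‖f k ω - p (f k ω)‖ ∂μ
        ≤ ∫ ω in A, (η / 2 + B.indicator (fun ω => ‖f k ω‖) ω) ∂μ :=
          setIntegral_mono ((hf k).sub hps).norm.integrableOn
            ((integrable_const _).add hi).integrableOn hpt
      _ = η / 2 * μ.real A + ∫ ω in A, B.indicator (fun ω => ‖f k ω‖) ω ∂μ := by
          rw [integral_add (integrable_const _) hi.integrableOn, setIntegral_const, smul_eq_mul,
            mul_comm]
      _ ≤ η / 2 * μ.real A + ∫ ω, B.indicator (fun ω => ‖f k ω‖) ω ∂μ := by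
          exact add_le_add le_rfl (setIntegral_le_integral hi
            (ae_of_all _ fun ω => Set.indicator_nonneg (fun _ _ => norm_nonneg _) _))
      _ ≤ η / 2 * μ.real A + η / 2 * μ.real A := by
          rw [integral_indicator hB]
          gcongr
      _ = η * μ.real A := by ring
  rw [dist_eq_norm, ← setAverage_sub (hf k).integrableOn hps.integrableOn]
  refine norm_setAverage_le.trans ?_
  rw [inv_mul_le_iff₀ ha, mul_comm]
  exact hint

theorem WeaklyConverges.tendsto_setIntegral_apply {f : ℕ → Ω → E} {f₀ : Ω → E}
    (h : WeaklyConverges μ f f₀) (x' : StrongDual ℝ E) {A : Set Ω} (hA : MeasurableSet A) :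
    Tendsto (fun k => ∫ ω in A, x' (f k ω) ∂μ) atTop (𝓝 (∫ ω in A, x' (f₀ ω) ∂μ)) := by
  classical
  have key : ∀ f : Ω → E, ∫ ω in A, x' (f ω) ∂μ
      = ∫ ω, A.piecewise (fun _ => x') (fun _ => (0 : StrongDual ℝ E)) ω (f ω) ∂μ := by
    intro f
    rw [← integral_indicator hA]
    congr 1 with ω
    by_cases hω : ω ∈ A <;> simp [hω]
  simp only [key]
  exact h _ ((isBoundedScalarlyMeasurable_const x').piecewise
    (isBoundedScalarlyMeasurable_const 0) hA)

/-- Under tightness and uniform integrability, weak convergence implies norm convergence of the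
averages over each fixed set. -/
theorem WeaklyConverges.tendsto_setAverage [IsFiniteMeasure μ] [CompleteSpace E]
    [TopologicalSpace.SeparableSpace E] [MeasurableSpace E] [BorelSpace E] {f : ℕ → Ω → E}
    {f₀ : Ω → E} (h : WeaklyConverges μ f f₀) (hf : ∀ k, Integrable (f k) μ)
    (hf₀ : Integrable f₀ μ) (hu : UnifIntegrable f 1 μ) (ht : IsTightFunctionSet μ (Set.range f))
    {A : Set Ω} (hA : MeasurableSet A) (hμA : 0 < μ A) :
    Tendsto (fun k => ⨍ ω in A, f k ω ∂μ) atTop (𝓝 (⨍ ω in A, f₀ ω ∂μ)) := by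
  have hK : IsCompact (closure (Set.range fun k => ⨍ ω in A, f k ω ∂μ)) :=
    isCompact_iff_totallyBounded_isComplete.2
      ⟨(totallyBounded_range_setAverage hf hu ht hμA).closure, isClosed_closure.isComplete⟩
  refine hK.tendsto_nhds_of_unique_mapClusterPt
    (Eventually.of_forall fun k => subset_closure ⟨k, rfl⟩) fun z _ hz => ?_
  obtain ⟨ψ, hψ, hψz⟩ := hz.tendsto_subseq
  -- Every cluster point has the same image under each functional as the average of `f₀`.
  refine (SeparatingDual.eq_iff_forall_dual_eq (R := ℝ)).2 fun x' => ?_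
  have hx' : ∀ f : Ω → E, Integrable f μ →
      x' (⨍ ω in A, f ω ∂μ) = (μ.real A)⁻¹ * ∫ ω in A, x' (f ω) ∂μ := by
    intro f hf
    rw [setAverage_eq, map_smul, smul_eq_mul, x'.integral_comp_comm hf.integrableOn]
  have h1 : Tendsto (fun j => x' (⨍ ω in A, f (ψ j) ω ∂μ)) atTop (𝓝 (x' z)) :=
    (x'.continuous.tendsto z).comp hψz
  have h2 := ((h.tendsto_setIntegral_apply x' hA).const_mul (μ.real A)⁻¹).comp hψ.tendsto_atTop
  rw [← hx' f₀ hf₀] at h2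
  refine tendsto_nhds_unique h1 (h2.congr fun j => ?_)
  exact (hx' _ (hf _)).symm

end Averages

/-! ### Exhaustion along subsequences -/

section Exhaustion

variable {Ω : Type*} [MeasurableSpace Ω] {μ : Measure Ω}

/-- If along every subsequence each set of positive measure has a subset of positive measure on
which the mean of `u` is frequently at most `c`, then the mean of `u` is at most `c` on a set of
almost full measure, along a subsequence. -/
theorem exists_infinite_setLIntegral_le [IsFiniteMeasure μ] {u : ℕ → Ω → ℝ≥0∞} {c : ℝ≥0∞}
    (H : ∀ φ : ℕ → ℕ, StrictMono φ → ∀ B, MeasurableSet B → 0 < μ B →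
      ∃ A, MeasurableSet A ∧ A ⊆ B ∧ 0 < μ A ∧ ∃ᶠ j in atTop, ∫⁻ ω in A, u (φ j) ω ∂μ ≤ c * μ A)
    {S : Set ℕ} (hS : S.Infinite) {δ : ℝ≥0∞} (hδ : 0 < δ) :
    ∃ S' ⊆ S, S'.Infinite ∧ ∃ A, MeasurableSet A ∧ μ Aᶜ ≤ δ ∧
      ∀ k ∈ S', ∫⁻ ω in A, u k ω ∂μ ≤ c * μ A := by
  let Good : Set ℕ × Set Ω → Prop := fun p =>
    p.1.Infinite ∧ MeasurableSet p.2 ∧ ∀ k ∈ p.1, ∫⁻ ω in p.2, u k ω ∂μ ≤ c * μ p.2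
  -- Greedy choice: `q` extends `p` with measure within `1 / (n + 1)` of the supremum over
  -- admissible extensions, where the index set may shrink.
  have step : ∀ (n : ℕ) (p : Set ℕ × Set Ω), Good p → ∃ q, Good q ∧ q.1 ⊆ p.1 ∧ p.2 ⊆ q.2 ∧
      ∀ r, Good r → r.1 ⊆ p.1 → p.2 ⊆ r.2 → μ.real r.2 < μ.real q.2 + 1 / (n + 1) := by
    intro n p hp
    set M : Set ℝ := {x | ∃ r, Good r ∧ r.1 ⊆ p.1 ∧ p.2 ⊆ r.2 ∧ μ.real r.2 = x}
    have hMne : M.Nonempty := ⟨_, p, hp, subset_rfl, subset_rfl, rfl⟩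
    have hMb : BddAbove M := by
      refine ⟨μ.real Set.univ, ?_⟩
      rintro _ ⟨r, -, -, -, rfl⟩
      exact measureReal_mono (Set.subset_univ _)
    obtain ⟨_, ⟨q, hq, hq1, hq2, rfl⟩, hlt⟩ := exists_lt_of_lt_csSup hMne
      (sub_lt_self (sSup M) (Nat.one_div_pos_of_nat (α := ℝ) (n := n)))
    refine ⟨q, hq, hq1, hq2, fun r hr hr1 hr2 => ?_⟩
    have := le_csSup hMb ⟨r, hr, hr1, hr2, rfl⟩
    linarith
  choose! N hN hN1 hN2 hNmax using step
  let p : ℕ → Set ℕ × Set Ω := fun n => Nat.rec (S, ∅) (fun n q => N n q) n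
  have hp : ∀ n, Good (p n) := by
    intro n
    induction n with
    | zero => exact ⟨hS, MeasurableSet.empty, fun k _ => by simp [p]⟩
    | succ n ih => exact hN n _ ih
  have hp1 : Antitone fun n => (p n).1 := antitone_nat_of_succ_le fun n => hN1 n _ (hp n)
  have hp2 : Monotone fun n => (p n).2 := monotone_nat_of_le_succ fun n => hN2 n _ (hp n)
  have hfull : μ (⋂ n, (p n).2ᶜ) = 0 := by
    by_contra hne
    -- Diagonal subsequence: `ψ j` belongs to every index set `(p n).1` with `n ≤ j`. If a set of
    -- positive measure were never covered, `H` along `ψ` would supply a subset `A` whose adjunction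
    -- at a late stage beats near maximality.
    obtain ⟨ψ, hψ, hψS⟩ := extraction_forall_of_frequently (P := fun n k => k ∈ (p n).1)
      fun n => Nat.frequently_atTop_iff_infinite.2 (hp n).1
    obtain ⟨A, hA, hAB, hμA, hfreq⟩ := H ψ hψ _
      (MeasurableSet.iInter fun n => (hp n).2.1.compl) (pos_iff_ne_zero.2 hne)
    have ha : 0 < μ.real A := ENNReal.toReal_pos hμA.ne' (measure_ne_top μ A)
    obtain ⟨n, hn⟩ := exists_nat_one_div_lt ha
    have hdisj : Disjoint (p (n + 1)).2 A :=
      Set.disjoint_left.2 fun ω h1 h2 => Set.mem_iInter.1 (hAB h2) (n + 1) h1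
    have hgood : Good (ψ '' {j | ∫⁻ ω in A, u (ψ j) ω ∂μ ≤ c * μ A ∧ n + 1 ≤ j},
        (p (n + 1)).2 ∪ A) := by
      refine ⟨?_, (hp (n + 1)).2.1.union hA, ?_⟩
      · exact (Nat.frequently_atTop_iff_infinite.1
          (hfreq.and_eventually (eventually_ge_atTop (n + 1)))).image hψ.injective.injOn
      · rintro _ ⟨j, ⟨hj, hnj⟩, rfl⟩
        change ∫⁻ ω in (p (n + 1)).2 ∪ A, u (ψ j) ω ∂μ ≤ c * μ ((p (n + 1)).2 ∪ A)
        rw [lintegral_union hA hdisj, measure_union hdisj hA, mul_add]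
        exact add_le_add ((hp (n + 1)).2.2 _ (hp1 hnj (hψS j))) hj
    have hlt := hNmax n _ (hp n) _ hgood (by
      rintro _ ⟨j, ⟨-, hnj⟩, rfl⟩
      exact hp1 ((Nat.le_succ n).trans hnj) (hψS j))
      ((hp2 (Nat.le_succ n)).trans Set.subset_union_left)
    change μ.real ((p (n + 1)).2 ∪ A) < μ.real (p (n + 1)).2 + 1 / (n + 1) at hlt
    rw [measureReal_union hdisj hA] at hlt
    linarith
  have hlim := tendsto_measure_iInter_atTop (μ := μ) (s := fun n => (p n).2ᶜ)
    (fun n => (hp n).2.1.compl.nullMeasurableSet)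
    (fun n m hnm => Set.compl_subset_compl.2 (hp2 hnm)) ⟨0, measure_ne_top μ _⟩
  rw [hfull] at hlim
  obtain ⟨n, hn⟩ := (hlim.eventually_le_const hδ).exists
  exact ⟨(p n).1, hp1 (Nat.zero_le n), (hp n).1, (p n).2, (hp n).2.1, hn, (hp n).2.2⟩

end Exhaustion

/-! ### From the Bocce criterion to strong convergence -/

section Bocce

variable {Ω E : Type*} [MeasurableSpace Ω] [NormedAddCommGroup E] {μ : Measure Ω}

/-- Each set of positive measure has a measurable subset of positive measure on which a given
strongly measurable function is almost constant. -/
theorem exists_subset_forall_norm_sub_le [TopologicalSpace.SeparableSpace E] {f : Ω → E}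
    (hf : AEStronglyMeasurable f μ) {B : Set Ω} (hB : MeasurableSet B) (hμB : 0 < μ B) {r : ℝ}
    (hr : 0 < r) : ∃ A, MeasurableSet A ∧ A ⊆ B ∧ 0 < μ A ∧ ∃ c, ∀ᵐ ω ∂μ, ω ∈ A → ‖f ω - c‖ ≤ r := by
  borelize E
  set e := TopologicalSpace.denseSeq E
  have hcov : ⋃ i, B ∩ hf.mk f ⁻¹' Metric.ball (e i) r = B := by
    rw [← Set.inter_iUnion, ← Set.preimage_iUnion, iUnion_ball_denseSeq E hr, Set.preimage_univ,
      Set.inter_univ]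
  obtain ⟨i, hi⟩ := exists_measure_pos_of_not_measure_iUnion_null
    (s := fun i => B ∩ hf.mk f ⁻¹' Metric.ball (e i) r) (by rw [hcov]; exact hμB.ne')
  refine ⟨_, hB.inter (hf.stronglyMeasurable_mk.measurable Metric.isOpen_ball.measurableSet),
    Set.inter_subset_left, hi, e i, ?_⟩
  filter_upwards [hf.ae_eq_mk] with ω hω hωA
  rw [hω, ← dist_eq_norm]
  exact (Metric.mem_ball.1 hωA.2).le

theorem setLIntegral_enorm_le_add_of_norm_le {f g : Ω → E} {A : Set Ω}
    (hA : MeasurableSet A) {r : ℝ} (h : ∀ᵐ ω ∂μ, ω ∈ A → ‖f ω‖ ≤ ‖g ω‖ + r) (hr : 0 ≤ r) :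
    ∫⁻ ω in A, ‖f ω‖ₑ ∂μ ≤ ∫⁻ ω in A, ‖g ω‖ₑ ∂μ + ENNReal.ofReal r * μ A := by
  calc ∫⁻ ω in A, ‖f ω‖ₑ ∂μ ≤ ∫⁻ ω in A, (‖g ω‖ₑ + ENNReal.ofReal r) ∂μ := by
        refine lintegral_mono_ae ((ae_restrict_iff' hA).2 (h.mono fun ω hω hωA => ?_))
        rw [← ofReal_norm, ← ofReal_norm, ← ENNReal.ofReal_add (norm_nonneg _) hr]
        exact ENNReal.ofReal_le_ofReal (hω hωA)
    _ = _ := by rw [lintegral_add_right _ measurable_const, setLIntegral_const]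

variable [NormedSpace ℝ E]

theorem norm_setAverage_sub_le [IsFiniteMeasure μ] [CompleteSpace E] {f : Ω → E}
    (hf : Integrable f μ) {A : Set Ω} (hA : MeasurableSet A) (hμA : 0 < μ A) {c : E} {r : ℝ}
    (h : ∀ᵐ ω ∂μ, ω ∈ A → ‖f ω - c‖ ≤ r) : ‖⨍ ω in A, f ω ∂μ - c‖ ≤ r := by
  have := (convex_closedBall c r).set_average_mem Metric.isClosed_closedBall hμA.ne'
    (measure_ne_top μ A) ((ae_restrict_iff' hA).2 (h.mono fun ω hω hωA =>
      mem_closedBall_iff_norm.2 (hω hωA))) hf.integrableOn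
  exact mem_closedBall_iff_norm.1 this

theorem SequentialBocceCriterion.exists_frequently_setLIntegral_le [IsFiniteMeasure μ]
    [CompleteSpace E] [TopologicalSpace.SeparableSpace E] {f : ℕ → Ω → E} {f₀ : Ω → E}
    (hb : SequentialBocceCriterion μ f) (hf₀ : Integrable f₀ μ)
    (hm : ∀ A, MeasurableSet A → 0 < μ A →
      Tendsto (fun k => ⨍ ω in A, f k ω ∂μ) atTop (𝓝 (⨍ ω in A, f₀ ω ∂μ)))
    {ε : ℝ} (hε : 0 < ε) {φ : ℕ → ℕ} (hφ : StrictMono φ) {B : Set Ω} (hB : MeasurableSet B)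
    (hμB : 0 < μ B) :
    ∃ A, MeasurableSet A ∧ A ⊆ B ∧ 0 < μ A ∧
      ∃ᶠ j in atTop, ∫⁻ ω in A, ‖f (φ j) ω - f₀ ω‖ₑ ∂μ ≤ ENNReal.ofReal ε * μ A := by
  have hε4 : 0 < ε / 4 := by positivity
  obtain ⟨B', hB', hBB', hμB', c, hc⟩ := exists_subset_forall_norm_sub_le hf₀.1 hB hμB hε4
  obtain ⟨A, hA, hAB', hμA, hlim⟩ := hb φ hφ (ε / 4) hε4 B' hB' hμB'
  have hcA : ∀ᵐ ω ∂μ, ω ∈ A → ‖f₀ ω - c‖ ≤ ε / 4 := hc.mono fun ω h hω => h (hAB' hω)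
  refine ⟨A, hA, hAB'.trans hBB', hμA, ?_⟩
  have hev := (((hm A hA hμA).comp hφ.tendsto_atTop).eventually (Metric.ball_mem_nhds _ hε4))
  refine ((frequently_lt_of_liminf_lt (by isBoundedDefault) hlim).and_eventually hev).mono ?_
  rintro j ⟨h1, h2⟩
  rw [Function.comp_apply, dist_eq_norm] at h2
  have h3 := norm_setAverage_sub_le hf₀ hA hμA hcA
  have h4 : ∫⁻ ω in A, ‖f (φ j) ω - ⨍ ω' in A, f (φ j) ω' ∂μ‖ₑ ∂μ ≤ ENNReal.ofReal (ε / 4) * μ A :=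
    (ENNReal.div_le_iff hμA.ne' (measure_ne_top μ A)).1 h1.le
  -- The three errors of `ε / 4` are: the two averages, the average of `f₀` against `c`, and `f₀`
  -- against `c`. The oscillation supplies the fourth.
  have h5 := setLIntegral_enorm_le_add_of_norm_le (μ := μ) (f := fun ω => f (φ j) ω - f₀ ω)
    (g := fun ω => f (φ j) ω - ⨍ ω' in A, f (φ j) ω' ∂μ) hA (r := 3 * (ε / 4))
    (hcA.mono fun ω hω hωA => by
      have e : f (φ j) ω - f₀ ω = (f (φ j) ω - ⨍ ω' in A, f (φ j) ω' ∂μ)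
          + ((⨍ ω' in A, f (φ j) ω' ∂μ - ⨍ ω' in A, f₀ ω' ∂μ)
          + ((⨍ ω' in A, f₀ ω' ∂μ - c) - (f₀ ω - c))) := by abel
      rw [e]
      refine (norm_add_le _ _).trans (add_le_add le_rfl ?_)
      refine (norm_add_le _ _).trans ?_
      have := norm_sub_le (⨍ ω' in A, f₀ ω' ∂μ - c) (f₀ ω - c)
      linarith [hω hωA]) (by positivity)
  calc _ ≤ _ := h5
    _ ≤ ENNReal.ofReal (ε / 4) * μ A + ENNReal.ofReal (3 * (ε / 4)) * μ A := by gcongr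
    _ = ENNReal.ofReal ε * μ A := by
      rw [← add_mul, ← ENNReal.ofReal_add hε4.le (by positivity)]
      congr 2
      ring

theorem WeaklyConverges.unifIntegrable_sub [TopologicalSpace.SeparableSpace E]
    {f : ℕ → Ω → E} {f₀ : Ω → E} (h : WeaklyConverges μ f f₀) (hf : ∀ k, Integrable (f k) μ)
    (hf₀ : Integrable f₀ μ) : UnifIntegrable (fun k ω => f k ω - f₀ ω) 1 μ := by
  refine unifIntegrable_of_weaklyConverges_zero (fun k => (hf k).sub hf₀) fun g hg => ?_
  have h1 := (h g hg).sub_const (∫ ω, g ω (f₀ ω) ∂μ)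
  rw [sub_self] at h1
  refine h1.congr fun k => ?_
  simp only [map_sub]
  exact (integral_sub (hg.integrable_apply (hf k)) (hg.integrable_apply hf₀)).symm

theorem stronglyConverges_of_weaklyConverges [IsFiniteMeasure μ] [CompleteSpace E]
    [TopologicalSpace.SeparableSpace E] [MeasurableSpace E] [BorelSpace E] {f : ℕ → Ω → E}
    {f₀ : Ω → E} (hf : ∀ k, Integrable (f k) μ) (hf₀ : Integrable f₀ μ)
    (hw : WeaklyConverges μ f f₀) (hb : SequentialBocceCriterion μ f)
    (ht : IsTightFunctionSet μ (Set.range f)) : StronglyConverges μ f f₀ := by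
  have hd : ∀ k, Integrable (fun ω => f k ω - f₀ ω) μ := fun k => (hf k).sub hf₀
  have hu := hw.unifIntegrable_sub hf hf₀
  have huf : UnifIntegrable f 1 μ := by
    have h := hu.add (unifIntegrable_const le_rfl ENNReal.one_ne_top (memLp_one_iff_integrable.2 hf₀))
      le_rfl (fun k => (hd k).1) fun _ => hf₀.1
    convert h using 1
    ext k ω
    simp
  have hm : ∀ A, MeasurableSet A → 0 < μ A →
      Tendsto (fun k => ⨍ ω in A, f k ω ∂μ) atTop (𝓝 (⨍ ω in A, f₀ ω ∂μ)) :=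
    fun A hA hμA => hw.tendsto_setAverage hf hf₀ huf ht hA hμA
  by_contra hcon
  obtain ⟨η, hη, hfreq⟩ : ∃ η : ℝ, 0 < η ∧
      ∃ᶠ k in atTop, η ≤ ∫ ω, ‖f k ω - f₀ ω‖ ∂μ := by
    by_contra! hall
    refine hcon (tendsto_order.2 ⟨fun a ha => Eventually.of_forall fun k =>
      ha.trans_le (integral_nonneg fun _ => norm_nonneg _), fun a ha => ?_⟩)
    simpa only [not_frequently, not_le] using hall a ha
  obtain ⟨δ, hδ, hδu⟩ := (unifIntegrable_one_iff hd).1 hu (η / 4) (by positivity)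
  have hm0 : 0 ≤ μ.real Set.univ := measureReal_nonneg
  -- This makes the contribution of `A` at most `η / 4`, as is that of `Aᶜ`; the `+ 1` avoids
  -- division by zero.
  set ε : ℝ := η / (4 * (μ.real Set.univ + 1)) with hεdef
  have hε : 0 < ε := by positivity
  obtain ⟨S, hS, hSinf, A, hA, hAδ, hAS⟩ := exists_infinite_setLIntegral_le (μ := μ)
    (u := fun k ω => ‖f k ω - f₀ ω‖ₑ) (c := ENNReal.ofReal ε)
    (fun φ hφ B hB hμB => hb.exists_frequently_setLIntegral_le hf₀ hm hε hφ hB hμB)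
    (Nat.frequently_atTop_iff_infinite.1 hfreq) (ENNReal.ofReal_pos.2 hδ)
  obtain ⟨k, hk⟩ := hSinf.nonempty
  have h1 : ∫ ω in A, ‖f k ω - f₀ ω‖ ∂μ ≤ ε * μ.real A := by
    have h := hAS k hk
    rw [← ofReal_integral_norm_eq_lintegral_enorm (hd k).integrableOn,
      ← ofReal_measureReal, ← ENNReal.ofReal_mul hε.le] at h
    exact (ENNReal.ofReal_le_ofReal_iff (mul_nonneg hε.le measureReal_nonneg)).1 h
  have h2 := hδu k Aᶜ hA.compl hAδ
  have h3 := integral_add_compl hA (hd k).norm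
  have h4 : η ≤ ∫ ω, ‖f k ω - f₀ ω‖ ∂μ := hS hk
  have h5 : ε * μ.real A ≤ η / 4 := by
    have h6 : ε * μ.real A ≤ ε * (μ.real Set.univ + 1) := by
      gcongr
      linarith [measureReal_mono (μ := μ) (Set.subset_univ A)]
    have h7 : ε * (μ.real Set.univ + 1) = η / 4 := by
      rw [hεdef]
      field_simp
    linarith
  linarith

end Bocce

/-! ### Consequences of strong convergence -/

section StrongConvergence

variable {Ω E : Type*} [MeasurableSpace Ω] [NormedAddCommGroup E] {μ : Measure Ω}
  {f : ℕ → Ω → E} {f₀ : Ω → E}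

theorem StronglyConverges.tendsto_lintegral (h : StronglyConverges μ f f₀)
    (hf : ∀ k, Integrable (f k) μ) (hf₀ : Integrable f₀ μ) :
    Tendsto (fun k => ∫⁻ ω, ‖f k ω - f₀ ω‖ₑ ∂μ) atTop (𝓝 0) := by
  have h1 := ENNReal.tendsto_ofReal h
  rw [ENNReal.ofReal_zero] at h1
  exact h1.congr fun k => ofReal_integral_norm_eq_lintegral_enorm ((hf k).sub hf₀)

theorem StronglyConverges.isTightFunctionSet [IsFiniteMeasure μ] [CompleteSpace E]
    [TopologicalSpace.SeparableSpace E] [MeasurableSpace E] [BorelSpace E]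
    (h : StronglyConverges μ f f₀) (hf : ∀ k, Integrable (f k) μ) (hf₀ : Integrable f₀ μ) :
    IsTightFunctionSet μ (Set.range f) := by
  refine isTightFunctionSet_range_of_tendstoInMeasure (fun k => (hf k).1) hf₀.1
    (tendstoInMeasure_of_tendsto_eLpNorm one_ne_zero (fun k => (hf k).1) hf₀.1 ?_)
  simp only [eLpNorm_one_eq_lintegral_enorm]
  exact h.tendsto_lintegral hf hf₀

variable [NormedSpace ℝ E]

theorem StronglyConverges.weaklyConverges [TopologicalSpace.SeparableSpace E]
    (h : StronglyConverges μ f f₀) (hf : ∀ k, Integrable (f k) μ) (hf₀ : Integrable f₀ μ) :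
    WeaklyConverges μ f f₀ := by
  intro g hg
  obtain ⟨C, hC⟩ := hg.bounded
  rw [tendsto_iff_norm_sub_tendsto_zero]
  have h1 := Tendsto.const_mul C h
  rw [mul_zero] at h1
  refine squeeze_zero (fun _ => norm_nonneg _) (fun k => ?_) h1
  rw [← integral_sub (hg.integrable_apply (hf k)) (hg.integrable_apply hf₀), ← integral_const_mul]
  refine norm_integral_le_of_norm_le (((hf k).sub hf₀).norm.const_mul C) (ae_of_all _ fun ω => ?_)
  rw [← map_sub]
  exact (g ω).le_of_opNorm_le (hC ω) _

/-- A set on which `f₀` is nearly constant serves for every subsequence: `f₀` has small oscillation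
there, and strong convergence transfers this to `f (φ j)`. -/
theorem StronglyConverges.sequentialBocceCriterion [IsFiniteMeasure μ] [CompleteSpace E]
    [TopologicalSpace.SeparableSpace E] (h : StronglyConverges μ f f₀)
    (hf : ∀ k, Integrable (f k) μ) (hf₀ : Integrable f₀ μ) : SequentialBocceCriterion μ f := by
  intro φ hφ ε hε B hB hμB
  have hε4 : 0 < ε / 4 := by positivity
  obtain ⟨A, hA, hAB, hμA, c, hc⟩ := exists_subset_forall_norm_sub_le hf₀.1 hB hμB hε4
  refine ⟨A, hA, hAB, hμA, ?_⟩
  have ha : 0 < μ.real A := ENNReal.toReal_pos hμA.ne' (measure_ne_top μ A)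
  have hev : ∀ᶠ j in atTop, ∫ ω, ‖f (φ j) ω - f₀ ω‖ ∂μ < ε / 16 * μ.real A :=
    (Tendsto.comp h hφ.tendsto_atTop).eventually_lt_const (by positivity)
  refine lt_of_le_of_lt (b := ENNReal.ofReal (3 * (ε / 4))) ?_
    ((ENNReal.ofReal_lt_ofReal_iff hε).2 (by linarith))
  refine liminf_le_of_frequently_le' (Eventually.frequently (hev.mono fun j hj => ?_))
  have hd : Integrable (fun ω => f (φ j) ω - f₀ ω) μ := (hf (φ j)).sub hf₀
  have hAd : ∫ ω in A, ‖f (φ j) ω - f₀ ω‖ ∂μ ≤ ε / 16 * μ.real A :=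
    (setIntegral_le_integral hd.norm (ae_of_all _ fun _ => norm_nonneg _)).trans hj.le
  have h1 : ‖⨍ ω in A, f (φ j) ω ∂μ - ⨍ ω in A, f₀ ω ∂μ‖ ≤ ε / 16 := by
    rw [← setAverage_sub (hf _).integrableOn hf₀.integrableOn]
    refine norm_setAverage_le.trans ?_
    rwa [inv_mul_le_iff₀ ha, mul_comm]
  have h2 := norm_setAverage_sub_le hf₀ hA hμA hc
  rw [bocceOsc, ENNReal.div_le_iff hμA.ne' (measure_ne_top μ A)]
  -- The errors beyond `f (φ j) ω - f₀ ω` sum to `9 * (ε / 16)`; the looser `11 * (ε / 16)` makes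
  -- the total `3 * (ε / 4)`.
  calc ∫⁻ ω in A, ‖f (φ j) ω - ⨍ ω' in A, f (φ j) ω' ∂μ‖ₑ ∂μ
      ≤ ∫⁻ ω in A, ‖f (φ j) ω - f₀ ω‖ₑ ∂μ + ENNReal.ofReal (11 * (ε / 16)) * μ A := by
        refine setLIntegral_enorm_le_add_of_norm_le hA (hc.mono fun ω hω hωA => ?_) (by positivity)
        have e : f (φ j) ω - ⨍ ω' in A, f (φ j) ω' ∂μ = (f (φ j) ω - f₀ ω)
            + (((f₀ ω - c) - (⨍ ω' in A, f₀ ω' ∂μ - c))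
            - (⨍ ω' in A, f (φ j) ω' ∂μ - ⨍ ω' in A, f₀ ω' ∂μ)) := by abel
        rw [e]
        refine (norm_add_le _ _).trans (add_le_add le_rfl ?_)
        refine (norm_sub_le _ _).trans ?_
        have := norm_sub_le (f₀ ω - c) (⨍ ω' in A, f₀ ω' ∂μ - c)
        linarith [hω hωA]
    _ ≤ ENNReal.ofReal (ε / 16) * μ A + ENNReal.ofReal (11 * (ε / 16)) * μ A := by
        gcongr
        rw [← ofReal_integral_norm_eq_lintegral_enorm hd.integrableOn, ← ofReal_measureReal,
          ← ENNReal.ofReal_mul (by positivity)]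
        exact ENNReal.ofReal_le_ofReal hAd
    _ = ENNReal.ofReal (3 * (ε / 4)) * μ A := by
        rw [← add_mul, ← ENNReal.ofReal_add (by positivity) (by positivity)]
        congr 2
        ring

end StrongConvergence

theorem theorem4p5 {Ω E : Type*} [MeasurableSpace Ω] (μ : Measure Ω) [IsFiniteMeasure μ]
    [NormedAddCommGroup E] [NormedSpace ℝ E] [CompleteSpace E]
    [TopologicalSpace.SeparableSpace E] [MeasurableSpace E] [BorelSpace E]
    (f : ℕ → Ω → E) (f₀ : Ω → E) (hf : ∀ k, Integrable (f k) μ) (hf₀ : Integrable f₀ μ) :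
    StronglyConverges μ f f₀ ↔
      WeaklyConverges μ f f₀ ∧ SequentialBocceCriterion μ f ∧
        IsTightFunctionSet μ (Set.range f) :=
  ⟨fun h => ⟨h.weaklyConverges hf hf₀, h.sequentialBocceCriterion hf hf₀,
    h.isTightFunctionSet hf hf₀⟩,
    fun h => stronglyConverges_of_weaklyConverges hf hf₀ h.1 h.2.1 h.2.2⟩
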